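/- There are absolute constants $\rho, c, \varepsilon_0 > 0$ such that the following holds for every integer $n \ge 1$ and every $\varepsilon \in (0, \varepsilon_0]$. Let $\mathcal{C}$ be a class of probability distributions over $\{0,1\}^n$ such that 1. the uniform distribution on $\{0,1\}^n$ belongs to $\mathcal{C}$; 2. $\mathcal{C}$ is learnable to accuracy $\varepsilon$ with $m = m(n,\varepsilon)$ samples: there is a (possibly randomized, not necessarily proper) algorithm which, given $m$ independent samples from any unknown $P \in \mathcal{C}$, outputs with probability at least $2/3$ a distribution $Q$ over $\{0,1\}^n$ with $d_{\mathrm{TV}}(Q,P) \le \varepsilon$; 3. $mn \le 2^{\rho n}$. Then every (possibly randomized) algorithm which tests whether an arbitrary distribution over $\{0,1\}^n$ belongs to $\mathcal{C}$ or is $\varepsilon$-far from every member of $\mathcal{C}$ uses at least $c \cdot 2^{n/2}/\varepsilon^2$ samples. Here such an algorithm, given $s$ independent samples from an unknown $P$, has to accept with probability at least $2/3$ if $P \in \mathcal{C}$, and to reject with probability at least $2/3$ if $d_{\mathrm{TV}}(P,Q) \ge \varepsilon$ for all $Q \in \mathcal{C}$; and $d_{\mathrm{TV}}(P,Q) = \frac12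 \sum_x |P(x)-Q(x)|$ is the total variation distance. -/

import Mathlib

open scoped BigOperators

noncomputable section

/-- The Boolean cube `{0,1}^n`. -/
abbrev Cube (n : ℕ) : Type := Fin n → Bool

/-- Probability distributions on `{0,1}^n`, given by their mass functions (with the Borel
`σ`-algebra that the simplex inherits from `ℝ^{2^n}`). -/
abbrev Distr (n : ℕ) : Type := stdSimplex ℝ (Cube n)

/-- The uniform distribution on `{0,1}^n`. -/
def uniformDistr (n : ℕ) : Distr n :=
  ⟨fun _ => ((2 : ℝ) ^ n)⁻¹, fun _ => by positivity, by simp⟩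

/-- Total variation distance, as half of the `ℓ¹` distance of the mass functions. -/
def tvDist {n : ℕ} (P Q : Distr n) : ℝ := (1 / 2) * ∑ x, |P.1 x - Q.1 x|

/-- Probability of the sequence `x` when `k` independent samples are drawn from `P`. -/
def sampleProb {n k : ℕ} (P : Distr n) (x : Fin k → Cube n) : ℝ := ∏ i, P.1 (x i)

/-- `C` can be learned to accuracy `ε` from `m` samples: there is a (possibly randomized, possibly
improper) algorithm which, for every unknown `P ∈ C`, outputs with probability at least `2/3` a
distribution at total variation distance at most `ε` from `P`. The measure `H x` is the law of the
output on the input `x`. -/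
def LearnableWith {n : ℕ} (C : Set (Distr n)) (ε : ℝ) (m : ℕ) : Prop :=
  ∃ H : (Fin m → Cube n) → MeasureTheory.ProbabilityMeasure (Distr n),
    ∀ P ∈ C,
      2 / 3 ≤ ∑ x, sampleProb P x *
        (H x : MeasureTheory.Measure (Distr n)).real {Q | tvDist Q P ≤ ε}

/-- `P` is `ε`-far from `C`: at total variation distance at least `ε` from every member. -/
def IsFar {n : ℕ} (C : Set (Distr n)) (ε : ℝ) (P : Distr n) : Prop :=
  ∀ Q ∈ C, ε ≤ tvDist P Q

/-- `C` can be tested with `s` samples at distance `ε`: there is a (possibly randomized) algorithm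
which accepts every `P ∈ C` with probability at least `2/3`, and rejects every `P` that is
`ε`-far from `C` with probability at least `2/3`. The number `T x` is the probability that the
algorithm accepts on the input `x`. -/
def TestableWith {n : ℕ} (C : Set (Distr n)) (ε : ℝ) (s : ℕ) : Prop :=
  ∃ T : (Fin s → Cube n) → unitInterval,
    (∀ P ∈ C, 2 / 3 ≤ ∑ x, sampleProb P x * (T x : ℝ)) ∧
    (∀ P, IsFar C ε P → 2 / 3 ≤ ∑ x, sampleProb P x * (1 - (T x : ℝ)))

end

/-! Write `n = k + 1`, and tilt the uniform distribution on each pair `(true, y)`, `(false, y)` by a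
sign `z y`, with relative size `δ = 32ε`. By a second-moment bound, fewer than `c * 2^(n/2) / ε^2`
samples cannot tell the mixture over all `z` from uniform (`abs_sum_perturbedDistr_sub_le`). A
tester accepts uniform, so at least a quarter of the `2^(2^k)` perturbations are within `ε` of `C`
(`TestableWith.card_le`).

That is too many to learn: `m` samples give `2^(nm)` inputs, and one output serves only sign
patterns in a small Hamming ball (`LearnableWith.card_le`, `card_le_of_hammingDist_le`). Hence `nm`
is of order `2^k`, against `mn ≤ 2^(ρn)`. For small `n` one nearby member suffices: one or two
samples cannot separate it from uniform (`LearnableWith.one_third_le`). -/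

open MeasureTheory

/-! ### Sums and Hamming balls on the cube -/

section Cube

lemma sum_cube_succ {k : ℕ} (F : Bool → Cube k → ℝ) :
    ∑ x : Cube (k + 1), F (x 0) (Fin.tail x) = ∑ y, (F true y + F false y) := by
  rw [← (Fin.consEquiv fun _ : Fin (k + 1) => Bool).sum_comp]
  simp [Fintype.sum_prod_type, Finset.sum_add_distrib, Fin.consEquiv]

/-- The sign of a bit. -/
def boolSign (b : Bool) : ℝ := if b then 1 else -1

@[simp] lemma boolSign_true : boolSign true = 1 := rfl

@[simp] lemma boolSign_false : boolSign false = -1 := rfl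

lemma sum_exp_boolSign {ι : Type*} [Fintype ι] [DecidableEq ι] (a : ℝ) (z : ι → Bool) :
    ∑ w : ι → Bool, Real.exp (a * ∑ y, boolSign (z y) * boolSign (w y))
      = (2 * Real.cosh a) ^ Fintype.card ι := by
  have h : ∀ y, ∑ b, Real.exp (a * (boolSign (z y) * boolSign b)) = 2 * Real.cosh a := by
    intro y
    rw [Real.cosh_eq]
    cases z y <;> simp <;> ring
  simp_rw [Finset.mul_sum, Real.exp_sum]
  rw [← Fintype.prod_sum fun y b => Real.exp (a * (boolSign (z y) * boolSign b))]
  simp_rw [h]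
  simp

lemma sum_half_pow_hammingDist {ι : Type*} [Fintype ι] [DecidableEq ι] (z : ι → Bool) :
    ∑ w : ι → Bool, (1 / 2 : ℝ) ^ hammingDist z w = (3 / 2) ^ Fintype.card ι := by
  have h : ∀ w : ι → Bool, (1 / 2 : ℝ) ^ hammingDist z w
      = ∏ y, if z y ≠ w y then (1 / 2 : ℝ) else 1 := by
    intro w
    rw [Finset.prod_ite]
    simp [hammingDist]
  have h' : ∀ y, ∑ b, (if z y ≠ b then (1 / 2 : ℝ) else 1) = 3 / 2 := by
    intro y
    cases z y <;> simp <;> norm_num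
  simp_rw [h]
  rw [← Fintype.prod_sum fun y b => if z y ≠ b then (1 / 2 : ℝ) else 1]
  simp_rw [h']
  rw [Finset.prod_const, Finset.card_univ]

/-- Chernoff-type count: weight `w` by `(1/2)^hammingDist z w`. The total weight is `(3/2)^(4q)`,
while each point of `A` weighs at least `2^(-r)`. -/
lemma card_le_of_hammingDist_le {ι : Type*} [Fintype ι] [DecidableEq ι] {q : ℕ}
    (hq : Fintype.card ι = 4 * q) (A : Finset (ι → Bool)) (z : ι → Bool)
    (hA : ∀ w ∈ A, 8 * hammingDist z w ≤ Fintype.card ι) : A.card ≤ 2 ^ (3 * q) := by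
  set r := Fintype.card ι / 8 with hr
  have h1 : (A.card : ℝ) * (1 / 2) ^ r ≤ (3 / 2) ^ Fintype.card ι := by
    rw [← sum_half_pow_hammingDist z, ← nsmul_eq_mul]
    calc A.card • (1 / 2 : ℝ) ^ r ≤ ∑ w ∈ A, (1 / 2 : ℝ) ^ hammingDist z w :=
          Finset.card_nsmul_le_sum _ _ _ fun w hw =>
            pow_le_pow_of_le_one (by norm_num) (by norm_num) (by have := hA w hw; omega)
      _ ≤ _ := Finset.sum_le_univ_sum_of_nonneg fun w => by positivity
  have h2 : (A.card : ℝ) ≤ (3 / 2) ^ Fintype.card ι * 2 ^ r := by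
    have h3 := mul_le_mul_of_nonneg_right h1 (by positivity : (0 : ℝ) ≤ 2 ^ r)
    rwa [mul_assoc, ← mul_pow, show (1 / 2 : ℝ) * 2 = 1 by norm_num, one_pow, mul_one] at h3
  -- Eighth powers absorb the floor in `r`, leaving `(3/2)^32 * 2^4 ≤ 2^24`.
  have h4 : (A.card : ℝ) ^ 8 ≤ ((2 : ℝ) ^ (3 * q)) ^ 8 := by
    calc (A.card : ℝ) ^ 8 ≤ ((3 / 2) ^ (4 * q) * 2 ^ r) ^ 8 := by
          rw [← hq]; gcongr
      _ = ((3 / 2) ^ 32) ^ q * 2 ^ (r * 8) := by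
          rw [mul_pow, ← pow_mul, ← pow_mul, ← pow_mul, mul_right_comm]
          norm_num
      _ ≤ ((3 / 2) ^ 32) ^ q * 2 ^ (4 * q) := by
          refine mul_le_mul_of_nonneg_left (pow_le_pow_right₀ (by norm_num) ?_) (by positivity)
          omega
      _ = ((3 / 2) ^ 32 * 2 ^ 4) ^ q := by rw [mul_pow, pow_mul]
      _ ≤ (2 ^ 24) ^ q := by gcongr; norm_num
      _ = _ := by rw [← pow_mul, ← pow_mul]; congr 1; ring
  exact_mod_cast le_of_pow_le_pow_left₀ (by norm_num) (by positivity) h4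

end Cube

/-! ### Samples and total variation -/

section Sampling

variable {n : ℕ}

lemma sampleProb_nonneg {k : ℕ} (P : Distr n) (x : Fin k → Cube n) : 0 ≤ sampleProb P x :=
  Finset.prod_nonneg fun i _ => P.2.1 (x i)

lemma sum_sampleProb {k : ℕ} (P : Distr n) : ∑ x : Fin k → Cube n, sampleProb P x = 1 := by
  simp only [sampleProb]
  rw [← Fintype.sum_pow, P.2.2, one_pow]

lemma sampleProb_le_one {k : ℕ} (P : Distr n) (x : Fin k → Cube n) : sampleProb P x ≤ 1 := by
  rw [← sum_sampleProb (k := k) P]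
  exact Finset.single_le_sum (fun y _ => sampleProb_nonneg P y) (Finset.mem_univ x)

lemma sampleProb_uniformDistr {k : ℕ} (x : Fin k → Cube n) :
    sampleProb (uniformDistr n) x = (((2 : ℝ) ^ n)⁻¹) ^ k := by
  simp [sampleProb, uniformDistr]

lemma tvDist_comm (P Q : Distr n) : tvDist P Q = tvDist Q P := by
  simp only [tvDist, abs_sub_comm]

lemma tvDist_triangle (P Q R : Distr n) : tvDist P R ≤ tvDist P Q + tvDist Q R := by
  simp only [tvDist]
  rw [← mul_add, ← Finset.sum_add_distrib]
  gcongr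
  exact abs_sub_le _ _ _

lemma measurableSet_tvDist_le (P : Distr n) (r : ℝ) :
    MeasurableSet {Q : Distr n | tvDist Q P ≤ r} := by
  refine measurableSet_le ?_ measurable_const
  unfold tvDist
  have h : ∀ x : Cube n, Measurable fun Q : Distr n => Q.1 x :=
    fun x => (measurable_pi_apply x).comp measurable_subtype_coe
  exact (Finset.measurable_sum _ fun x _ => ((h x).sub_const _).abs).const_mul _

/-- Product distributions are at `ℓ¹` distance at most the sum of those of the factors. -/
lemma sum_abs_sampleProb_sub_le (P Q : Distr n) (k : ℕ) :
    ∑ x : Fin k → Cube n, |sampleProb P x - sampleProb Q x| ≤ k * (2 * tvDist P Q) := by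
  induction k with
  | zero => simp [sampleProb]
  | succ k ih =>
    have hd : 2 * tvDist P Q = ∑ a, |P.1 a - Q.1 a| := by unfold tvDist; ring
    rw [← (Fin.consEquiv fun _ : Fin (k + 1) => Cube n).sum_comp, Fintype.sum_prod_type]
    calc ∑ a, ∑ x : Fin k → Cube n, |sampleProb P (Fin.cons a x : Fin (k + 1) → Cube n)
            - sampleProb Q (Fin.cons a x : Fin (k + 1) → Cube n)|
        ≤ ∑ a, ∑ x : Fin k → Cube n, (|P.1 a - Q.1 a| * sampleProb P x
            + Q.1 a * |sampleProb P x - sampleProb Q x|) := by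
          gcongr with a _ x _
          have h1 : sampleProb P (Fin.cons a x : Fin (k + 1) → Cube n)
              - sampleProb Q (Fin.cons a x : Fin (k + 1) → Cube n)
              = (P.1 a - Q.1 a) * sampleProb P x
                + Q.1 a * (sampleProb P x - sampleProb Q x) := by
            simp [sampleProb, Fin.prod_univ_succ]; ring
          rw [h1]
          refine (abs_add_le _ _).trans (le_of_eq ?_)
          rw [abs_mul, abs_mul, abs_of_nonneg (sampleProb_nonneg P x), abs_of_nonneg (Q.2.1 a)]
      _ = ∑ a, |P.1 a - Q.1 a|
            + ∑ x : Fin k → Cube n, |sampleProb P x - sampleProb Q x| := by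
          simp_rw [Finset.sum_add_distrib, ← Finset.mul_sum, sum_sampleProb, mul_one]
          rw [← Finset.sum_mul, Q.2.2, one_mul]
      _ ≤ _ := by
          rw [← hd]; push_cast; linarith

end Sampling

/-! ### Limits of learners -/

section Learning

variable {n : ℕ}

/-- Integrate the number of sets `B i` that contain a given point. -/
lemma sum_measureReal_le_of_card_le {α ι : Type*} [MeasurableSpace α] [DecidableEq ι]
    (μ : Measure α) [IsProbabilityMeasure μ] (G : Finset ι) (B : ι → Set α)
    (hB : ∀ i ∈ G, MeasurableSet (B i)) (V : ℕ)
    (hV : ∀ a, ∀ A ⊆ G, (∀ i ∈ A, a ∈ B i) → A.card ≤ V) :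
    ∑ i ∈ G, μ.real (B i) ≤ V := by
  classical
  have hint : ∀ i ∈ G, Integrable ((B i).indicator (1 : α → ℝ)) μ := fun i hi =>
    (integrable_const (1 : ℝ)).indicator (hB i hi)
  calc ∑ i ∈ G, μ.real (B i) = ∑ i ∈ G, ∫ a, (B i).indicator (1 : α → ℝ) a ∂μ :=
        Finset.sum_congr rfl fun i hi => (integral_indicator_one (hB i hi)).symm
    _ = ∫ a, ∑ i ∈ G, (B i).indicator (1 : α → ℝ) a ∂μ := (integral_finsetSum _ hint).symm
    _ ≤ ∫ _, (V : ℝ) ∂μ := by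
        refine integral_mono (integrable_finsetSum _ hint) (integrable_const _) fun a => ?_
        have h := hV a (G.filter fun i => a ∈ B i) (Finset.filter_subset _ _) (by simp)
        simp only [Set.indicator_apply, Pi.one_apply, Finset.sum_boole]
        exact_mod_cast h
    _ = V := by simp

/-- A learner with `m` samples has only `2 ^ (n * m)` inputs, so that it cannot succeed on many
distributions that are spread out. -/
lemma LearnableWith.card_le {C : Set (Distr n)} {ε : ℝ} {m : ℕ} (h : LearnableWith C ε m)
    {ι : Type*} [DecidableEq ι] (G : Finset ι) (Q : ι → Distr n) (hQ : ∀ i ∈ G, Q i ∈ C) (V : ℕ)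
    (hV : ∀ R, ∀ A ⊆ G, (∀ i ∈ A, tvDist R (Q i) ≤ ε) → A.card ≤ V) :
    (G.card : ℝ) * (2 / 3) ≤ 2 ^ (n * m) * V := by
  obtain ⟨H, hH⟩ := h
  rw [← nsmul_eq_mul]
  calc G.card • (2 / 3 : ℝ)
      ≤ ∑ i ∈ G, ∑ x, sampleProb (Q i) x *
          (H x : Measure (Distr n)).real {R | tvDist R (Q i) ≤ ε} :=
        Finset.card_nsmul_le_sum _ _ _ fun i hi => hH _ (hQ i hi)
    _ ≤ ∑ i ∈ G, ∑ x, (H x : Measure (Distr n)).real {R | tvDist R (Q i) ≤ ε} := by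
        gcongr with i _ x _
        exact mul_le_of_le_one_left measureReal_nonneg (sampleProb_le_one _ _)
    _ = ∑ x, ∑ i ∈ G, (H x : Measure (Distr n)).real {R | tvDist R (Q i) ≤ ε} :=
        Finset.sum_comm
    _ ≤ ∑ _x : Fin m → Cube n, (V : ℝ) := by
        gcongr with x _
        exact sum_measureReal_le_of_card_le _ G _ (fun i _ => measurableSet_tvDist_le _ _) V hV
    _ = 2 ^ (n * m) * V := by simp [pow_mul]

/-- A learner with few samples cannot tell apart two members that are close to each other, but
not within twice its accuracy. -/
lemma LearnableWith.one_third_le {C : Set (Distr n)} {ε : ℝ} {m : ℕ} (h : LearnableWith C ε m)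
    {P Q : Distr n} (hP : P ∈ C) (hQ : Q ∈ C) (hPQ : 2 * ε < tvDist P Q) :
    1 / 3 ≤ m * (2 * tvDist P Q) := by
  obtain ⟨H, hH⟩ := h
  have h1 := add_le_add (hH P hP) (hH Q hQ)
  rw [← Finset.sum_add_distrib] at h1
  have h2 := sum_abs_sampleProb_sub_le Q P m
  rw [tvDist_comm Q P] at h2
  have h3 : ∀ x : Fin m → Cube n,
      sampleProb P x * (H x : Measure (Distr n)).real {R | tvDist R P ≤ ε}
        + sampleProb Q x * (H x : Measure (Distr n)).real {R | tvDist R Q ≤ ε}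
      ≤ sampleProb P x + |sampleProb Q x - sampleProb P x| := by
    intro x
    set p := (H x : Measure (Distr n)).real {R | tvDist R P ≤ ε}
    set q := (H x : Measure (Distr n)).real {R | tvDist R Q ≤ ε}
    have hdisj : Disjoint {R : Distr n | tvDist R P ≤ ε} {R : Distr n | tvDist R Q ≤ ε} := by
      rw [Set.disjoint_left]
      intro R h1 h2
      simp only [Set.mem_ofPred_eq] at h1 h2
      have := tvDist_triangle P R Q
      rw [tvDist_comm P R] at this
      linarith
    have hpq : p + q ≤ 1 := by
      rw [← measureReal_union hdisj (measurableSet_tvDist_le Q ε)]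
      exact measureReal_le_one
    have hq0 : 0 ≤ q := measureReal_nonneg
    have hq1 : q ≤ 1 := measureReal_le_one
    have hP0 := sampleProb_nonneg P x
    have h5 : (sampleProb Q x - sampleProb P x) * q ≤ |sampleProb Q x - sampleProb P x| :=
      (mul_le_mul_of_nonneg_right (le_abs_self _) hq0).trans
        (mul_le_of_le_one_right (abs_nonneg _) hq1)
    -- With masses `P`, `Q` at `x`: `P p + Q q = P (p + q) + (Q - P) q`.
    nlinarith [mul_le_mul_of_nonneg_left hpq hP0]
  have h4 := h1.trans (Finset.sum_le_sum fun x _ => h3 x)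
  rw [Finset.sum_add_distrib, sum_sampleProb] at h4
  linarith

end Learning

/-! ### The perturbed family and its mixture -/

section Perturbation

variable {k : ℕ}

/-- The uniform distribution, with the masses of `(true, y)` and `(false, y)` shifted in opposite
directions, by a relative amount `δ` whose sign is given by `z y`. -/
noncomputable def perturbedDistr (δ : ℝ) (hδ : |δ| ≤ 1) (z : Cube k → Bool) : Distr (k + 1) :=
  ⟨fun x => (1 + δ * (boolSign (x 0) * boolSign (z (Fin.tail x)))) / 2 ^ (k + 1), fun x => by
    have h := abs_le.1 hδ
    refine div_nonneg ?_ (by positivity)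
    cases x 0 <;> cases z (Fin.tail x) <;> simp <;> linarith, by
    rw [sum_cube_succ fun b y => (1 + δ * (boolSign b * boolSign (z y))) / 2 ^ (k + 1)]
    have h : ∀ y, (1 + δ * (boolSign true * boolSign (z y))) / 2 ^ (k + 1)
        + (1 + δ * (boolSign false * boolSign (z y))) / 2 ^ (k + 1) = ((2 : ℝ) ^ k)⁻¹ := by
      intro y
      rw [pow_succ]
      simp only [boolSign_true, boolSign_false]
      field_simp
      ring
    simp_rw [h]
    simp⟩

variable {δ : ℝ} (hδ : |δ| ≤ 1)

lemma perturbedDistr_apply (z : Cube k → Bool) (x : Cube (k + 1)) :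
    (perturbedDistr δ hδ z).1 x
      = (1 + δ * (boolSign (x 0) * boolSign (z (Fin.tail x)))) / 2 ^ (k + 1) := rfl

lemma tvDist_perturbedDistr_uniformDistr (hδ0 : 0 ≤ δ) (z : Cube k → Bool) :
    tvDist (perturbedDistr δ hδ z) (uniformDistr (k + 1)) = δ / 2 := by
  have h : ∀ x, |(perturbedDistr δ hδ z).1 x - (uniformDistr (k + 1)).1 x|
      = δ / 2 ^ (k + 1) := by
    intro x
    rw [perturbedDistr_apply]
    have h1 : (1 + δ * (boolSign (x 0) * boolSign (z (Fin.tail x)))) / 2 ^ (k + 1)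
        - (uniformDistr (k + 1)).1 x
        = δ / 2 ^ (k + 1) * (boolSign (x 0) * boolSign (z (Fin.tail x))) := by
      simp only [uniformDistr]; ring
    rw [h1, abs_mul, abs_of_nonneg (by positivity : 0 ≤ δ / 2 ^ (k + 1))]
    cases x 0 <;> cases z (Fin.tail x) <;> simp
  simp only [tvDist, h]
  simp
  field_simp

lemma tvDist_perturbedDistr (hδ0 : 0 ≤ δ) (z w : Cube k → Bool) :
    tvDist (perturbedDistr δ hδ z) (perturbedDistr δ hδ w) = δ * hammingDist z w / 2 ^ k := by
  simp only [tvDist, perturbedDistr_apply]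
  rw [sum_cube_succ fun b y => |(1 + δ * (boolSign b * boolSign (z y))) / 2 ^ (k + 1)
    - (1 + δ * (boolSign b * boolSign (w y))) / 2 ^ (k + 1)|]
  have h : ∀ y b, |(1 + δ * (boolSign b * boolSign (z y))) / 2 ^ (k + 1)
      - (1 + δ * (boolSign b * boolSign (w y))) / 2 ^ (k + 1)|
      = δ / 2 ^ k * if z y ≠ w y then 1 else 0 := by
    intro y b
    have h1 : (1 + δ * (boolSign b * boolSign (z y))) / 2 ^ (k + 1)
        - (1 + δ * (boolSign b * boolSign (w y))) / 2 ^ (k + 1)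
        = δ / 2 ^ k * (boolSign b * (boolSign (z y) - boolSign (w y)) / 2) := by
      rw [pow_succ]; field_simp; ring
    rw [h1, abs_mul, abs_of_nonneg (by positivity : 0 ≤ δ / 2 ^ k)]
    cases b <;> cases z y <;> cases w y <;> norm_num
  simp_rw [h]
  rw [Finset.sum_add_distrib, ← Finset.mul_sum]
  simp only [Finset.sum_boole, hammingDist]
  ring

lemma sum_perturbedDistr_mul (z w : Cube k → Bool) :
    ∑ x, (perturbedDistr δ hδ z).1 x * (perturbedDistr δ hδ w).1 x
      = (1 + δ ^ 2 / 2 ^ k * ∑ y, boolSign (z y) * boolSign (w y)) * ((2 : ℝ) ^ (k + 1))⁻¹ := by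
  simp only [perturbedDistr_apply]
  rw [sum_cube_succ fun b y => (1 + δ * (boolSign b * boolSign (z y))) / 2 ^ (k + 1)
    * ((1 + δ * (boolSign b * boolSign (w y))) / 2 ^ (k + 1))]
  have h : ∀ y, (1 + δ * (boolSign true * boolSign (z y))) / 2 ^ (k + 1)
      * ((1 + δ * (boolSign true * boolSign (w y))) / 2 ^ (k + 1))
      + (1 + δ * (boolSign false * boolSign (z y))) / 2 ^ (k + 1)
      * ((1 + δ * (boolSign false * boolSign (w y))) / 2 ^ (k + 1))
      = (((2 : ℝ) ^ k)⁻¹ + δ ^ 2 / 2 ^ k * (boolSign (z y) * boolSign (w y)))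
        * ((2 : ℝ) ^ (k + 1))⁻¹ := by
    intro y
    rw [pow_succ]
    simp only [boolSign_true, boolSign_false]
    field_simp
    ring
  simp_rw [h]
  rw [← Finset.sum_mul, Finset.sum_add_distrib, ← Finset.mul_sum]
  simp

/-- The second moment of the mixture of the perturbed distributions. -/
lemma sum_sq_sum_sampleProb_perturbedDistr_le (s : ℕ) :
    ∑ x : Fin s → Cube (k + 1), (∑ z, sampleProb (perturbedDistr δ hδ z) x) ^ 2
      ≤ ((2 : ℝ) ^ 2 ^ k) ^ 2 * ((((2 : ℝ) ^ (k + 1))⁻¹) ^ s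
        * Real.exp ((s : ℝ) ^ 2 * δ ^ 4 / (2 * 2 ^ k))) := by
  set u : ℝ := ((2 : ℝ) ^ (k + 1))⁻¹ with hu
  have hu0 : 0 < u := by positivity
  set a : ℝ := s * (δ ^ 2 / 2 ^ k) with ha
  -- Independence makes the correlation an `s`-th power; then `1 + t ≤ exp t` makes it factor over
  -- `y`.
  have hpair : ∀ z w : Cube k → Bool, ∑ x : Fin s → Cube (k + 1),
      sampleProb (perturbedDistr δ hδ z) x * sampleProb (perturbedDistr δ hδ w) x
      ≤ u ^ s * Real.exp (a * ∑ y, boolSign (z y) * boolSign (w y)) := by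
    intro z w
    simp only [sampleProb, ← Finset.prod_mul_distrib]
    rw [← Fintype.sum_pow
      (fun x => (perturbedDistr δ hδ z).1 x * (perturbedDistr δ hδ w).1 x)]
    have h0 : 0 ≤ ∑ x, (perturbedDistr δ hδ z).1 x * (perturbedDistr δ hδ w).1 x :=
      Finset.sum_nonneg fun x _ =>
        mul_nonneg ((perturbedDistr δ hδ z).2.1 x) ((perturbedDistr δ hδ w).2.1 x)
    rw [sum_perturbedDistr_mul] at h0 ⊢
    rw [mul_pow, mul_comm]
    refine mul_le_mul_of_nonneg_left ?_ (by positivity)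
    rw [ha, mul_assoc, Real.exp_nat_mul]
    refine pow_le_pow_left₀ (nonneg_of_mul_nonneg_left h0 hu0) ?_ _
    rw [add_comm]
    exact Real.add_one_le_exp _
  calc ∑ x : Fin s → Cube (k + 1), (∑ z, sampleProb (perturbedDistr δ hδ z) x) ^ 2
      = ∑ z, ∑ w, ∑ x : Fin s → Cube (k + 1),
        sampleProb (perturbedDistr δ hδ z) x * sampleProb (perturbedDistr δ hδ w) x := by
        simp_rw [sq, Finset.sum_mul_sum]
        rw [Finset.sum_comm]
        exact Finset.sum_congr rfl fun z _ => Finset.sum_comm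
    _ ≤ ∑ z : Cube k → Bool, ∑ w : Cube k → Bool,
        u ^ s * Real.exp (a * ∑ y, boolSign (z y) * boolSign (w y)) := by
        gcongr with z _ w _
        exact hpair z w
    _ = ((2 : ℝ) ^ 2 ^ k) ^ 2 * (u ^ s * Real.cosh a ^ 2 ^ k) := by
        simp_rw [← Finset.mul_sum, sum_exp_boolSign]
        simp [mul_pow]
        ring
    _ ≤ _ := by
        have h : Real.cosh a ^ 2 ^ k ≤ Real.exp ((s : ℝ) ^ 2 * δ ^ 4 / (2 * 2 ^ k)) := by
          calc Real.cosh a ^ 2 ^ k ≤ Real.exp (a ^ 2 / 2) ^ 2 ^ k :=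
                pow_le_pow_left₀ (Real.cosh_pos a).le (Real.cosh_le_exp_half_sq a) _
            _ = _ := by
                rw [← Real.exp_nat_mul, ha]
                congr 1
                push_cast
                field_simp
        gcongr

/-- With few samples, the mixture of the perturbed distributions cannot be told from the uniform
distribution. -/
lemma abs_sum_perturbedDistr_sub_le {s : ℕ} (hs : (s : ℝ) ^ 2 * δ ^ 4 ≤ 2 ^ k / 36)
    (T : (Fin s → Cube (k + 1)) → unitInterval) :
    |∑ z, ∑ x, sampleProb (perturbedDistr δ hδ z) x * (T x : ℝ)
      - (2 : ℝ) ^ 2 ^ k * ∑ x, sampleProb (uniformDistr (k + 1)) x * (T x : ℝ)|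
      ≤ (2 : ℝ) ^ 2 ^ k / 6 := by
  set D : ℝ := (2 : ℝ) ^ 2 ^ k with hD
  set u : ℝ := (((2 : ℝ) ^ (k + 1))⁻¹) ^ s with hu
  set A : (Fin s → Cube (k + 1)) → ℝ := fun x => ∑ z, sampleProb (perturbedDistr δ hδ z) x
  set t : ℝ := (s : ℝ) ^ 2 * δ ^ 4 / (2 * 2 ^ k) with ht
  have hu0 : 0 < u := by positivity
  have hD0 : 0 < D := by positivity
  have hcard : ∑ _x : Fin s → Cube (k + 1), u = 1 := by
    rw [← sum_sampleProb (k := s) (uniformDistr (k + 1))]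
    exact Finset.sum_congr rfl fun x _ => (sampleProb_uniformDistr x).symm
  have hexp : Real.exp t - 1 ≤ 1 / 36 := by
    have h0 : 0 ≤ t := by positivity
    have h1 : t ≤ 1 / 72 := by
      rw [ht, div_le_iff₀ (by positivity)]
      linarith
    have h2 := (le_abs_self _).trans (Real.abs_exp_sub_one_le (x := t) (by
      rw [abs_of_nonneg h0]; linarith))
    rw [abs_of_nonneg h0] at h2
    linarith
  have hA : ∑ x, A x = D := by
    simp only [A]
    rw [Finset.sum_comm]
    simp [sum_sampleProb, hD]
  have hvar : ∑ x, (A x - D * u) ^ 2 ≤ D ^ 2 * u * (1 / 36) := by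
    have h1 : ∑ x, (A x - D * u) ^ 2 = ∑ x, A x ^ 2 - D ^ 2 * u := by
      have h2 : ∀ x, (A x - D * u) ^ 2 = A x ^ 2 - 2 * D * u * A x + D ^ 2 * u * u := by
        intro x; ring
      simp_rw [h2]
      rw [Finset.sum_add_distrib, Finset.sum_sub_distrib, ← Finset.mul_sum, ← Finset.mul_sum, hA,
        hcard]
      ring
    have h3 := sum_sq_sum_sampleProb_perturbedDistr_le (k := k) hδ s
    rw [h1]
    have h4 := mul_le_mul_of_nonneg_left hexp (by positivity : 0 ≤ D ^ 2 * u)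
    linarith
  have hT : ∑ x, (T x : ℝ) ^ 2 ≤ u⁻¹ := by
    rw [← one_div, le_div_iff₀ hu0, Finset.sum_mul, ← hcard]
    exact Finset.sum_le_sum fun x _ =>
      mul_le_of_le_one_left hu0.le (pow_le_one₀ (T x).2.1 (T x).2.2)
  -- Cauchy–Schwarz: the deviation of `A` from its mean `D * u`, against the test `T`.
  have hsq : (∑ x, (A x - D * u) * (T x : ℝ)) ^ 2 ≤ (D / 6) ^ 2 := by
    refine (Finset.sum_mul_sq_le_sq_mul_sq _ _ _).trans ?_
    calc (∑ x, (A x - D * u) ^ 2) * ∑ x, (T x : ℝ) ^ 2 ≤ D ^ 2 * u * (1 / 36) * u⁻¹ :=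
          mul_le_mul hvar hT (Finset.sum_nonneg fun x _ => sq_nonneg _) (by positivity)
      _ = (D / 6) ^ 2 := by field_simp; norm_num
  have heq : ∑ z, ∑ x, sampleProb (perturbedDistr δ hδ z) x * (T x : ℝ)
      - D * ∑ x, sampleProb (uniformDistr (k + 1)) x * (T x : ℝ)
      = ∑ x, (A x - D * u) * (T x : ℝ) := by
    rw [Finset.sum_comm, Finset.mul_sum, ← Finset.sum_sub_distrib]
    refine Finset.sum_congr rfl fun x _ => ?_
    rw [sampleProb_uniformDistr, ← Finset.sum_mul]
    ring
  rw [heq]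
  exact abs_le_of_sq_le_sq hsq (by positivity)

/-- If a class that contains the uniform distribution can be tested with few samples, then many of
the perturbed distributions are close to a member. -/
lemma TestableWith.card_le {C : Set (Distr (k + 1))} {ε : ℝ} {s : ℕ} (h : TestableWith C ε s)
    (hU : uniformDistr (k + 1) ∈ C) (hs : (s : ℝ) ^ 2 * δ ^ 4 ≤ 2 ^ k / 36)
    (G : Finset (Cube k → Bool))
    (hG : ∀ z ∉ G, IsFar C ε (perturbedDistr δ hδ z)) : (2 : ℝ) ^ 2 ^ k ≤ 4 * G.card := by
  classical
  obtain ⟨T, hT, hT'⟩ := h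
  have h1 := (abs_le.1 (abs_sum_perturbedDistr_sub_le hδ hs T)).1
  have h2 := mul_le_mul_of_nonneg_left (hT _ hU) (by positivity : (0 : ℝ) ≤ 2 ^ 2 ^ k)
  have h3 : ∀ z, ∑ x, sampleProb (perturbedDistr δ hδ z) x * (T x : ℝ)
      ≤ 1 / 3 + if z ∈ G then 2 / 3 else 0 := by
    intro z
    split_ifs with hz
    · rw [show (1 / 3 + 2 / 3 : ℝ) = 1 by norm_num,
        ← sum_sampleProb (k := s) (perturbedDistr δ hδ z)]
      exact Finset.sum_le_sum fun x _ =>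
        mul_le_of_le_one_right (sampleProb_nonneg _ _) (T x).2.2
    · have h4 := hT' _ (hG z hz)
      simp_rw [mul_sub, mul_one] at h4
      rw [Finset.sum_sub_distrib, sum_sampleProb] at h4
      linarith
  have h5 := Finset.sum_le_sum fun z (_ : z ∈ Finset.univ) => h3 z
  have h6 : ∑ z : Cube k → Bool, (1 / 3 + if z ∈ G then 2 / 3 else 0 : ℝ)
      = (2 : ℝ) ^ 2 ^ k / 3 + G.card * (2 / 3) := by
    rw [Finset.sum_add_distrib]
    simp
    ring
  rw [h6] at h5
  linarith

end Perturbation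

/-! ### Conclusion -/

/-- A learner with few samples cannot cope with a class that comes close to a constant fraction of
the perturbed distributions. -/
lemma lt_of_learnableWith_of_perturbedDistr_near {k m q : ℕ} (hk : 2 ^ k = 4 * q) {δ ε : ℝ} (hδ : |δ| ≤ 1)
    (hε : 0 < ε) (hδε : δ = 32 * ε) {C : Set (Distr (k + 1))} (hlearn : LearnableWith C ε m)
    (G : Finset (Cube k → Bool))
    (hG : ∀ z ∈ G, ∃ Q ∈ C, tvDist (perturbedDistr δ hδ z) Q < ε)
    (hcard : (2 : ℝ) ^ 2 ^ k ≤ 4 * G.card) : q < (k + 1) * m + 3 := by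
  classical
  choose! Q hQC hQ using hG
  have h1 := hlearn.card_le G Q hQC (2 ^ (3 * q)) fun R A hAG hA => by
    obtain rfl | ⟨z, hz⟩ := A.eq_empty_or_nonempty
    · simp
    refine card_le_of_hammingDist_le (by simp [hk]) A z fun w hw => ?_
    -- Four legs of length at most `ε`, through `Q z`, `R`, `Q w`; as `δ = 32ε`, the Hamming
    -- distance is at most `2^k / 8`.
    have h2 := tvDist_triangle (perturbedDistr δ hδ z) (Q z) (perturbedDistr δ hδ w)
    have h3 := tvDist_triangle (Q z) R (perturbedDistr δ hδ w)
    have h4 := tvDist_triangle R (Q w) (perturbedDistr δ hδ w)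
    have h5 := hA z hz
    have h6 := hA w hw
    have h7 := hQ z (hAG hz)
    have h8 := hQ w (hAG hw)
    rw [tvDist_comm] at h5 h8
    rw [tvDist_perturbedDistr hδ (by linarith)] at h2
    have h9 : δ * hammingDist z w / 2 ^ k ≤ 4 * ε := by linarith
    rw [div_le_iff₀ (by positivity), hδε] at h9
    have h10 : (8 * hammingDist z w : ℝ) ≤ 2 ^ k := by
      have : 4 * ε * (8 * hammingDist z w) ≤ 4 * ε * 2 ^ k := by linarith
      exact le_of_mul_le_mul_left this (by linarith)
    have h11 : 8 * hammingDist z w ≤ 2 ^ k := by exact_mod_cast h10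
    simpa using h11
  -- The factor `4 * (3/2) = 6 < 2^3` gives the `+ 3`.
  have h2 : (2 : ℝ) ^ (3 * q) * 2 ^ q < 2 ^ (3 * q) * 2 ^ ((k + 1) * m + 3) := by
    rw [← pow_add, show 3 * q + q = 2 ^ k by omega]
    rw [pow_add _ _ 3]
    push_cast at h1
    have : (0 : ℝ) < 2 ^ ((k + 1) * m) * 2 ^ (3 * q) := by positivity
    linarith
  exact (pow_lt_pow_iff_right₀ (by norm_num : (1 : ℝ) < 2)).1
    (lt_of_mul_lt_mul_left h2 (by positivity))

theorem theoremB1 :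
    ∃ ρ c ε₀ : ℝ, 0 < ρ ∧ 0 < c ∧ 0 < ε₀ ∧
      ∀ (n : ℕ) (_hn : 1 ≤ n) (ε : ℝ) (_hε : 0 < ε) (_hε₀ : ε ≤ ε₀)
        (C : Set (Distr n)) (_hU : uniformDistr n ∈ C)
        (m : ℕ) (_hlearn : LearnableWith C ε m)
        (_hm : (m : ℝ) * (n : ℝ) ≤ (2 : ℝ) ^ (ρ * (n : ℝ)))
        (s : ℕ) (_htest : TestableWith C ε s),
          c * (2 : ℝ) ^ ((n : ℝ) / 2) / ε ^ 2 ≤ (s : ℝ) := by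
  classical
  -- `c` yields `s^2 δ^4 ≤ 2^20 * 2^(-28) * 2^(k+1) = 2^k / 128`; `ε₀` gives `δ ≤ 1` and `68ε <
  -- 1/3`, used for small `k`.
  refine ⟨1 / 6, 1 / 2 ^ 14, 1 / 300, by norm_num, by norm_num, by norm_num, ?_⟩
  intro n hn ε hε hε₀ C hU m hlearn hm s htest
  obtain ⟨k, rfl⟩ := Nat.exists_eq_add_of_le' hn
  by_contra! hs
  set δ : ℝ := 32 * ε with hδε
  have hδ0 : 0 ≤ δ := by positivity
  have hδ : |δ| ≤ 1 := by rw [abs_of_nonneg hδ0]; linarith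
  have hs2 : (s : ℝ) ^ 2 * δ ^ 4 ≤ 2 ^ k / 36 := by
    rw [lt_div_iff₀ (by positivity)] at hs
    have h1 : ((s : ℝ) * ε ^ 2) ^ 2 ≤ (1 / 2 ^ 14 * (2 : ℝ) ^ (((k + 1 : ℕ) : ℝ) / 2)) ^ 2 :=
      pow_le_pow_left₀ (by positivity) hs.le _
    have h2 : ((2 : ℝ) ^ (((k + 1 : ℕ) : ℝ) / 2)) ^ 2 = 2 ^ k * 2 := by
      rw [← Real.rpow_natCast, ← Real.rpow_mul (by norm_num), ← pow_succ]
      rw [← Real.rpow_natCast]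
      congr 1
      push_cast
      ring
    rw [mul_pow (1 / 2 ^ 14), h2] at h1
    have h3 : (0 : ℝ) < 2 ^ k := by positivity
    rw [hδε]
    linarith
  set G : Finset (Cube k → Bool) :=
    Finset.univ.filter fun z => ∃ Q ∈ C, tvDist (perturbedDistr δ hδ z) Q < ε with hGdef
  have hG : ∀ z ∈ G, ∃ Q ∈ C, tvDist (perturbedDistr δ hδ z) Q < ε := fun z hz =>
    (Finset.mem_filter.1 hz).2
  have hcard : (2 : ℝ) ^ 2 ^ k ≤ 4 * G.card :=
    htest.card_le hδ hU hs2 G fun z hz Q hQ => by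
      by_contra! hlt
      exact hz (Finset.mem_filter.2 ⟨Finset.mem_univ z, Q, hQ, hlt⟩)
  by_cases hk : 5 ≤ k
  · obtain ⟨j, rfl⟩ := Nat.exists_eq_add_of_le hk
    have h1 := lt_of_learnableWith_of_perturbedDistr_near (q := 2 ^ (j + 3)) (by ring) hδ hε hδε hlearn G hG
      hcard
    have h2 : (m : ℝ) * ((5 + j + 1 : ℕ) : ℝ) ≤ 2 ^ (j + 1) := by
      refine hm.trans ?_
      rw [← Real.rpow_natCast]
      refine Real.rpow_le_rpow_of_exponent_le (by norm_num) ?_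
      push_cast
      have : (0 : ℝ) ≤ j := by positivity
      linarith
    have h3 : m * (5 + j + 1) ≤ 2 ^ (j + 1) := by exact_mod_cast h2
    have h4 : 1 ≤ 2 ^ j := Nat.one_le_two_pow
    rw [mul_comm] at h3
    rw [pow_succ] at h3
    rw [pow_add] at h1
    omega
  -- Counting can fail here. A member near a perturbation lies between `15ε` and `17ε` from uniform,
  -- so the two-point bound would need `1/3 ≤ 2 * 2 * 17ε`.
  · have hm2 : (m : ℝ) ≤ 2 := by
      have h1 : (2 : ℝ) ^ (1 / 6 * ((k + 1 : ℕ) : ℝ)) ≤ 2 ^ (1 : ℝ) := by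
        refine Real.rpow_le_rpow_of_exponent_le (by norm_num) ?_
        have : ((k + 1 : ℕ) : ℝ) ≤ 6 := by exact_mod_cast (by omega : k + 1 ≤ 6)
        linarith
      rw [Real.rpow_one] at h1
      have h2 : (1 : ℝ) ≤ ((k + 1 : ℕ) : ℝ) := by exact_mod_cast hn
      have h3 := le_mul_of_one_le_right (Nat.cast_nonneg (α := ℝ) m) h2
      linarith
    have hne : G.Nonempty := by
      rw [← Finset.card_pos]
      have : (0 : ℝ) < 2 ^ 2 ^ k := by positivity
      exact_mod_cast (by linarith : (0 : ℝ) < G.card)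
    obtain ⟨z, hz⟩ := hne
    obtain ⟨Q, hQC, hQ⟩ := hG z hz
    have h1 := tvDist_perturbedDistr_uniformDistr hδ hδ0 z
    have h2 := tvDist_triangle (perturbedDistr δ hδ z) Q (uniformDistr (k + 1))
    have h3 := tvDist_triangle (uniformDistr (k + 1)) (perturbedDistr δ hδ z) Q
    rw [tvDist_comm Q] at h2
    rw [tvDist_comm _ (perturbedDistr δ hδ z)] at h3
    have h4 := hlearn.one_third_le hU hQC (by linarith)
    have h5 := mul_le_mul_of_nonneg_right hm2
      (by linarith : 0 ≤ 2 * tvDist (uniformDistr (k + 1)) Q)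
    linarith
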